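/- Let $\alpha\in(0,1)$, $c>0$, $a>0$, and for $s\ge 0$ put $$f^{\alpha,c,a}(s)=\frac{4s}{a\pi}\int_0^\infty\frac{\sin^2(u/2)}{u^2}\Bigl(1-e^{-2c(u/s)^\alpha}\Bigr)\,\mathrm du\quad(s>0),\qquad f^{\alpha,c,a}(0)=0 .$$ Let $G^{\alpha,c,a}=\{G^{\alpha,c,a}(s):s\in[0,\infty)\}$ be a centered real-valued Gaussian process with (almost surely) continuous paths and covariance $$\mathrm{Cov}\bigl(G^{\alpha,c,a}(s),G^{\alpha,c,a}(r)\bigr)=\tfrac12\bigl(f^{\alpha,c,a}(s)+f^{\alpha,c,a}(r)-f^{\alpha,c,a}(|s-r|)\bigr),\qquad s,r\ge0.$$ For $b>0$ let $\widetilde G^{\alpha,c,a}_b(s):=G^{\alpha,c,a}(bs)/\sqrt{b^{1-\alpha}}$, $s\in[0,\infty)$. Let $W_H$ with $H=\frac{1-\alpha}{2}$ be a fractional Brownian motion with Hurst parameter $H$, i.e. a centered Gaussian process on $[0,\infty)$ with (almost surely) continuous paths and covariance $\mathrm{Cov}(W_H(s),W_H(r))=\frac12\bigl(s^{2H}+r^{2H}-|s-r|^{2H}\bigr)$.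 Then, as $b\to\infty$, $$\{\widetilde G^{\alpha,c,a}_b(s):s\in[0,\infty)\}\ \Rightarrow\ \{k_{\alpha,c,a}^{1/2}\,W_{\frac{1-\alpha}{2}}(s):s\in[0,\infty)\}$$ weakly in $C[0,\infty)$ (with the topology of locally uniform convergence), where $$k_{\alpha,c,a}=\frac{4c}{a\pi}\,\Gamma(\alpha-1)\,\sin\!\Bigl(-\frac{\alpha\pi}{2}\Bigr)$$ is positive and $\Gamma$ on $(-1,0)$ is the analytic continuation of the Gamma function, $\Gamma(x)=\Gamma(x+1)/x$. -/

import Mathlib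

open MeasureTheory ProbabilityTheory Filter
open scoped NNReal Topology

noncomputable section

namespace NumVar

/-- The path space `C[0,∞)` carries the compact-open topology (locally uniform convergence), which
is Mathlib's topology on `C(ℝ≥0, ℝ)`, and its Borel σ-algebra. -/
instance pathMeasurableSpace : MeasurableSpace C(ℝ≥0, ℝ) := borel _

instance pathBorelSpace : BorelSpace C(ℝ≥0, ℝ) := ⟨rfl⟩

/-- The number variance function
`f(s) = (4 s / (a π)) ∫₀^∞ (sin² (u/2) / u²) (1 - exp (-2 c (u/s)^α)) du`; at `s = 0` it is `0`. -/
def f (α c a s : ℝ) : ℝ :=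
  4 * s / (a * Real.pi) *
    ∫ u in Set.Ioi (0 : ℝ),
      Real.sin (u / 2) ^ 2 / u ^ 2 * (1 - Real.exp (-2 * c * (u / s) ^ α))

/-- `X` is a centered real Gaussian process on `[0,∞)` with covariance function `ρ` and almost
surely continuous paths. -/
structure IsContinuousCenteredGaussian {Ω : Type*} [MeasurableSpace Ω]
    (X : ℝ≥0 → Ω → ℝ) (ρ : ℝ≥0 → ℝ≥0 → ℝ) (P : Measure Ω) : Prop where
  gaussian : IsGaussianProcess X P
  mean_zero : ∀ s, ∫ ω, X s ω ∂P = 0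
  covariance_eq : ∀ s r, cov[X s, X r; P] = ρ s r
  continuous_paths : ∀ᵐ ω ∂P, Continuous fun s => X s ω

/-- `G` is a version of the limiting fluctuation process `G^{α,c,a}`. -/
def IsFluctuationProcess {Ω : Type*} [MeasurableSpace Ω] (α c a : ℝ)
    (G : ℝ≥0 → Ω → ℝ) (P : Measure Ω) : Prop :=
  IsContinuousCenteredGaussian G
    (fun s r => (f α c a s + f α c a r - f α c a |(s : ℝ) - r|) / 2) P

/-- `W` is a fractional Brownian motion with Hurst parameter `H` (self-similarity is a consequence
of the covariance). -/
def IsFractionalBrownianMotion {Ω : Type*} [MeasurableSpace Ω] (H : ℝ)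
    (W : ℝ≥0 → Ω → ℝ) (P : Measure Ω) : Prop :=
  IsContinuousCenteredGaussian W
    (fun s r => ((s : ℝ) ^ (2 * H) + (r : ℝ) ^ (2 * H) - |(s : ℝ) - r| ^ (2 * H)) / 2) P

/-- The rescaled process `s ↦ X(b s) / √(b^(1-α))`. -/
def rescale {Ω : Type*} (α : ℝ) (b : ℝ≥0) (X : ℝ≥0 → Ω → ℝ) : ℝ≥0 → Ω → ℝ :=
  fun s ω => X (b * s) ω / Real.sqrt ((b : ℝ) ^ (1 - α))

/-- The constant `k = (4 c / (a π)) Γ(α-1) sin (-α π / 2)`. -/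
def k (α c a : ℝ) : ℝ :=
  4 * c / (a * Real.pi) * Real.Gamma (α - 1) * Real.sin (-α * Real.pi / 2)

open Classical in
/-- The random element of `C[0,∞)` given by the paths of `X`; on the event (a null event for the
processes considered) where the path is discontinuous it is set to the zero path. -/
def path {Ω : Type*} (X : ℝ≥0 → Ω → ℝ) (ω : Ω) : C(ℝ≥0, ℝ) :=
  if h : Continuous (fun s => X s ω) then ⟨fun s => X s ω, h⟩ else 0

end NumVar

end

namespace NumVar

/-! The law of a centered Gaussian process is determined by its covariance, so weak convergence on
path space reduces to convergence of covariances plus tightness. Both follow from comparing `f` with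
a power. The inequality 1 - e^(-x) ≤ x inside the integral gives f(s) ≤ k s^(1-α) for every s ≥ 0
(`f_le`), and dominated convergence shows that this bound is asymptotically sharp as s → ∞
(`tendsto_f_div_rpow`). The constant comes from ∫ (1 - cos u) u^(α-2) du = Γ(α-1) sin(-απ/2) over
(0,∞), obtained from Laplace representations, an exchange of integrals and the reflection formula
(`integral_one_sub_cos_mul_rpow`).

After rescaling, the variance of an increment over distance x is f(bx)/b^(1-α). It tends to k
x^(1-α), which identifies the limit as k^(1/2) times fractional Brownian motion. It is also at most
k x^(1-α) for every b, a Hölder bound uniform in b. The exponent 1-α is below 1, so second moments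
do not suffice; high Gaussian moments and dyadic chaining give tightness
(`isTightMeasureSet_map_path`). Convergent covariances give convergent finite-dimensional
characteristic functions, which together with tightness yield the theorem
(`tendsto_of_isTight_of_tendsto_charFun`). -/

/-! ### Evaluation of the integral behind the constant `k` -/

/-- Exchange of the two iterated integrals of a nonnegative kernel on the quadrant. -/
lemma integral_Ioi_swap {κ : ℝ → ℝ → ℝ} {A B : ℝ → ℝ}
    (hm : Measurable (Function.uncurry κ))
    (h0 : ∀ x ∈ Set.Ioi (0 : ℝ), ∀ y ∈ Set.Ioi (0 : ℝ), 0 ≤ κ x y)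
    (hA : ∀ x ∈ Set.Ioi (0 : ℝ), ∫ y in Set.Ioi (0 : ℝ), κ x y = A x)
    (hB : ∀ y ∈ Set.Ioi (0 : ℝ), ∫ x in Set.Ioi (0 : ℝ), κ x y = B y)
    (hBi : ∀ y ∈ Set.Ioi (0 : ℝ), IntegrableOn (fun x => κ x y) (Set.Ioi 0))
    (hBint : IntegrableOn B (Set.Ioi 0)) :
    IntegrableOn A (Set.Ioi 0) ∧
      ∫ x in Set.Ioi (0 : ℝ), A x = ∫ y in Set.Ioi (0 : ℝ), B y := by
  have hint : Integrable (Function.uncurry κ)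
      ((volume.restrict (Set.Ioi (0 : ℝ))).prod (volume.restrict (Set.Ioi (0 : ℝ)))) := by
    -- Since the kernel is nonnegative, the inner integral of its norm is `B`, so integrability on
    -- the product reduces to that of `B`.
    rw [integrable_prod_iff' hm.aestronglyMeasurable]
    refine ⟨?_, ?_⟩
    · filter_upwards [ae_restrict_mem measurableSet_Ioi] with y hy using hBi y hy
    · refine hBint.congr ?_
      filter_upwards [ae_restrict_mem measurableSet_Ioi] with y hy
      rw [← hB y hy]
      refine setIntegral_congr_fun measurableSet_Ioi fun x hx => ?_
      simp [abs_of_nonneg (h0 x hx y hy)]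
  have hAe : A =ᵐ[volume.restrict (Set.Ioi 0)] fun x => ∫ y in Set.Ioi (0 : ℝ), κ x y := by
    filter_upwards [ae_restrict_mem measurableSet_Ioi] with x hx using (hA x hx).symm
  have hBe : B =ᵐ[volume.restrict (Set.Ioi 0)] fun y => ∫ x in Set.Ioi (0 : ℝ), κ x y := by
    filter_upwards [ae_restrict_mem measurableSet_Ioi] with x hx using (hB x hx).symm
  refine ⟨hint.integral_prod_left.congr hAe.symm, ?_⟩
  rw [integral_congr_ae hAe, integral_congr_ae hBe]
  exact integral_integral_swap hint

/-- An explicit antiderivative `F` vanishes at infinity; nonnegativity of the integrand then gives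
integrability as well as the value. -/
lemma one_sub_cos_laplace {t : ℝ} (ht : 0 < t) :
    IntegrableOn (fun u => (1 - Real.cos u) * Real.exp (-(t * u))) (Set.Ioi 0) ∧
      ∫ u in Set.Ioi (0 : ℝ), (1 - Real.cos u) * Real.exp (-(t * u)) = 1 / (t * (1 + t ^ 2)) := by
  have ht2 : (1 + t ^ 2) ≠ 0 := by positivity
  let F : ℝ → ℝ := fun u =>
    Real.exp (-(t * u)) * (-(1 / t) - (Real.sin u - t * Real.cos u) / (1 + t ^ 2))
  have hderiv : ∀ x ∈ Set.Ici (0 : ℝ),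
      HasDerivAt F ((1 - Real.cos x) * Real.exp (-(t * x))) x := by
    intro x _
    have h1 : HasDerivAt (fun u : ℝ => Real.exp (-(t * u))) (Real.exp (-(t * x)) * -(t * 1)) x :=
      ((hasDerivAt_id x).const_mul t).neg.exp
    have h2 : HasDerivAt (fun u : ℝ => -(1 / t) - (Real.sin u - t * Real.cos u) / (1 + t ^ 2))
        (-((Real.cos x - t * -Real.sin x) / (1 + t ^ 2))) x :=
      (((Real.hasDerivAt_sin x).sub ((Real.hasDerivAt_cos x).const_mul t)).div_const _).const_sub _
    refine (h1.mul h2).congr_deriv ?_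
    field_simp
    ring
  have hnn : ∀ x ∈ Set.Ioi (0 : ℝ), 0 ≤ (1 - Real.cos x) * Real.exp (-(t * x)) := fun x _ =>
    mul_nonneg (sub_nonneg.2 (Real.cos_le_one x)) (Real.exp_pos _).le
  have hlim : Tendsto F atTop (𝓝 0) := by
    have he : Tendsto (fun u : ℝ => Real.exp (-(t * u))) atTop (𝓝 0) :=
      Real.tendsto_exp_neg_atTop_nhds_zero.comp (tendsto_id.const_mul_atTop ht)
    refine he.zero_mul_isBoundedUnder_le ?_
    refine isBoundedUnder_of ⟨1 / t + (1 + t) / (1 + t ^ 2), fun u => ?_⟩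
    simp only [Function.comp_apply, Real.norm_eq_abs]
    refine (abs_sub _ _).trans (add_le_add ?_ ?_)
    · rw [abs_neg, abs_of_pos (by positivity)]
    · rw [abs_div, abs_of_pos (a := 1 + t ^ 2) (by positivity)]
      gcongr
      refine (abs_sub _ _).trans (add_le_add (Real.abs_sin_le_one u) ?_)
      rw [abs_mul, abs_of_pos ht]
      exact mul_le_of_le_one_right ht.le (Real.abs_cos_le_one u)
  refine ⟨integrableOn_Ioi_deriv_of_nonneg' hderiv hnn hlim, ?_⟩
  rw [integral_Ioi_of_hasDerivAt_of_nonneg' hderiv hnn hlim]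
  simp only [F, mul_zero, neg_zero, Real.exp_zero, Real.sin_zero, Real.cos_zero]
  field_simp
  ring

/-- A non-integrable function has Bochner integral `0`, so the positive Gamma value forces
integrability. -/
lemma integrableOn_rpow_mul_exp {a r : ℝ} (ha : 0 < a) (hr : 0 < r) :
    IntegrableOn (fun t : ℝ => t ^ (a - 1) * Real.exp (-(r * t))) (Set.Ioi 0) := by
  by_contra h
  have h1 := Real.integral_rpow_mul_exp_neg_mul_Ioi ha hr
  rw [integral_undef h] at h1
  have := Real.Gamma_pos_of_pos ha
  have : 0 < (1 / r) ^ a * Real.Gamma a := by positivity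
  linarith

/-- Write 1/(1+t²) as ∫ e^(-(1+t²)y) dy and exchange: the result is ½ Γ((1-α)/2) Γ((1+α)/2), which
the reflection formula evaluates. -/
lemma integral_rpow_div_one_add_sq {α : ℝ} (hα : α ∈ Set.Ioo (0 : ℝ) 1) :
    IntegrableOn (fun t : ℝ => t ^ (-α) / (1 + t ^ 2)) (Set.Ioi 0) ∧
      ∫ t in Set.Ioi (0 : ℝ), t ^ (-α) / (1 + t ^ 2) =
        Real.pi / (2 * Real.cos (α * Real.pi / 2)) := by
  obtain ⟨hα0, hα1⟩ := hα
  have hs : 0 < (1 + α) / 2 := by linarith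
  have hinner : ∀ y ∈ Set.Ioi (0 : ℝ),
      ∫ x in Set.Ioi (0 : ℝ), x ^ (-α) * Real.exp (-(1 + x ^ 2) * y) =
        1 / 2 * Real.Gamma ((1 - α) / 2) * (y ^ ((1 + α) / 2 - 1) * Real.exp (-(1 * y))) := by
    intro y hy
    have h := integral_rpow_mul_exp_neg_mul_rpow (p := 2) (q := -α) (b := y) two_pos
      (by linarith) hy
    have : ∀ x : ℝ, x ^ (-α) * Real.exp (-(1 + x ^ 2) * y) =
        Real.exp (-y) * (x ^ (-α) * Real.exp (-y * x ^ (2 : ℝ))) := by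
      intro x
      rw [mul_left_comm, ← Real.exp_add]
      congr 2
      norm_num
      ring
    simp_rw [this]
    rw [integral_const_mul, h]
    have e1 : -(-α + 1) / 2 = (1 + α) / 2 - 1 := by ring
    have e2 : (-α + 1) / 2 = (1 - α) / 2 := by ring
    rw [e1, e2]
    ring_nf
  have hint : ∀ y ∈ Set.Ioi (0 : ℝ),
      IntegrableOn (fun x : ℝ => x ^ (-α) * Real.exp (-(1 + x ^ 2) * y)) (Set.Ioi 0) := by
    intro y hy
    by_contra h
    have h1 := hinner y hy
    rw [integral_undef h] at h1
    have := Real.Gamma_pos_of_pos (s := (1 - α) / 2) (by linarith)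
    have hy' : (0 : ℝ) < y := hy
    have : 0 < 1 / 2 * Real.Gamma ((1 - α) / 2) *
      (y ^ ((1 + α) / 2 - 1) * Real.exp (-(1 * y))) := by positivity
    linarith
  have key := integral_Ioi_swap (κ := fun x y => x ^ (-α) * Real.exp (-(1 + x ^ 2) * y))
    (A := fun t : ℝ => t ^ (-α) / (1 + t ^ 2))
    (by unfold Function.uncurry; fun_prop)
    (fun x hx y hy => mul_nonneg (Real.rpow_nonneg (le_of_lt hx) _) (Real.exp_pos _).le)
    (fun x hx => by
      rw [integral_const_mul, integral_exp_mul_Ioi (by nlinarith [sq_nonneg x])]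
      have h1 : 1 + x ^ 2 ≠ 0 := by positivity
      rw [mul_zero, Real.exp_zero, neg_div_neg_eq, mul_one_div])
    hinner hint ((integrableOn_rpow_mul_exp hs one_pos).const_mul _)
  refine ⟨key.1, key.2.trans ?_⟩
  rw [integral_const_mul, Real.integral_rpow_mul_exp_neg_mul_Ioi hs one_pos]
  have hG := Real.Gamma_mul_Gamma_one_sub ((1 - α) / 2)
  have e1 : 1 - (1 - α) / 2 = (1 + α) / 2 := by ring
  have e2 : Real.pi * ((1 - α) / 2) = Real.pi / 2 - α * Real.pi / 2 := by ring
  rw [e1, e2, Real.sin_pi_div_two_sub] at hG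
  rw [div_one, Real.one_rpow, one_mul, mul_assoc, hG]
  ring

/-- Write Γ(2-α) u^(α-2) as ∫ t^(1-α) e^(-ut) dt; after the exchange, the Laplace transform of 1 -
cos leaves ∫ t^(-α)/(1+t²) dt. -/
lemma integral_one_sub_cos_mul_rpow {α : ℝ} (hα : α ∈ Set.Ioo (0 : ℝ) 1) :
    IntegrableOn (fun u : ℝ => (1 - Real.cos u) * u ^ (α - 2)) (Set.Ioi 0) ∧
      ∫ u in Set.Ioi (0 : ℝ), (1 - Real.cos u) * u ^ (α - 2) =
        Real.Gamma (α - 1) * Real.sin (-α * Real.pi / 2) := by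
  have hα0 := hα.1
  have hα1 := hα.2
  have hs : 0 < 2 - α := by linarith
  have hΓ := Real.Gamma_pos_of_pos hs
  obtain ⟨hi, he⟩ := integral_rpow_div_one_add_sq hα
  have key := integral_Ioi_swap
    (κ := fun u t => (1 - Real.cos u) * (t ^ (2 - α - 1) * Real.exp (-(u * t))))
    (A := fun u : ℝ => Real.Gamma (2 - α) * ((1 - Real.cos u) * u ^ (α - 2)))
    (B := fun t : ℝ => t ^ (-α) / (1 + t ^ 2))
    (by unfold Function.uncurry; fun_prop)
    (fun u hu t ht => mul_nonneg (sub_nonneg.2 (Real.cos_le_one u))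
      (mul_nonneg (Real.rpow_nonneg (le_of_lt ht) _) (Real.exp_pos _).le))
    (fun u hu => by
      rw [integral_const_mul, Real.integral_rpow_mul_exp_neg_mul_Ioi hs hu, one_div,
        Real.inv_rpow (le_of_lt hu), ← Real.rpow_neg (le_of_lt hu), neg_sub]
      ring)
    (fun t ht => by
      have ht' : (0 : ℝ) < t := ht
      have : ∀ u : ℝ, (1 - Real.cos u) * (t ^ (2 - α - 1) * Real.exp (-(u * t))) =
          t ^ (2 - α - 1) * ((1 - Real.cos u) * Real.exp (-(t * u))) := by
        intro u; rw [mul_comm u t]; ring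
      simp_rw [this]
      rw [integral_const_mul, (one_sub_cos_laplace ht').2,
        show 2 - α - 1 = -α + 1 by ring, Real.rpow_add_one ht'.ne']
      field_simp)
    (fun t ht => by
      refine ((one_sub_cos_laplace ht).1.const_mul (t ^ (2 - α - 1))).congr ?_
      refine Eventually.of_forall fun u => ?_
      simp only [mul_comm u t]
      ring)
    hi
  refine ⟨?_, ?_⟩
  · refine (key.1.const_mul (Real.Gamma (2 - α))⁻¹).congr (Eventually.of_forall fun u => ?_)
    simp only
    field_simp
  · have h2 := key.2
    rw [integral_const_mul, he] at h2
    -- Reflection at the negative argument `α - 1` brings in the continued value Γ(α-1).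
    have hG := Real.Gamma_mul_Gamma_one_sub (α - 1)
    rw [show 1 - (α - 1) = 2 - α by ring,
      show Real.pi * (α - 1) = α * Real.pi - Real.pi by ring, Real.sin_sub_pi,
      show α * Real.pi = 2 * (α * Real.pi / 2) by ring, Real.sin_two_mul] at hG
    have hpi := Real.pi_pos
    have hc : 0 < Real.cos (α * Real.pi / 2) :=
      Real.cos_pos_of_mem_Ioo ⟨by nlinarith, by nlinarith⟩
    have hsn : 0 < Real.sin (α * Real.pi / 2) :=
      Real.sin_pos_of_pos_of_lt_pi (by positivity) (by nlinarith)
    refine mul_left_cancel₀ hΓ.ne' (h2.trans ?_)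
    rw [show -α * Real.pi / 2 = -(α * Real.pi / 2) by ring, Real.sin_neg,
      show Real.Gamma (2 - α) * (Real.Gamma (α - 1) * -Real.sin (α * Real.pi / 2)) =
        -(Real.Gamma (α - 1) * Real.Gamma (2 - α) * Real.sin (α * Real.pi / 2)) by ring, hG]
    generalize Real.sin (α * Real.pi / 2) = x at *
    generalize Real.cos (α * Real.pi / 2) = y at *
    field_simp

lemma k_pos {α c a : ℝ} (hα : α ∈ Set.Ioo (0 : ℝ) 1) (hc : 0 < c) (ha : 0 < a) :
    0 < k α c a := by
  obtain ⟨h0, h1⟩ := hα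
  have hpi := Real.pi_pos
  have hs : Real.sin (-α * Real.pi / 2) < 0 :=
    Real.sin_neg_of_neg_of_neg_pi_lt (by nlinarith [mul_pos h0 hpi]) (by nlinarith)
  have hg : Real.Gamma (α - 1) < 0 := by
    have := Real.Gamma_add_one (s := α - 1) (by linarith)
    rw [sub_add_cancel] at this
    have := Real.Gamma_pos_of_pos h0
    nlinarith
  unfold k
  rw [mul_assoc]
  exact mul_pos (by positivity) (mul_pos_of_neg_of_neg hg hs)

/-- The integrand of `f` after linearising the exponential. -/
lemma integral_sin_sq_mul_rpow {α : ℝ} (hα : α ∈ Set.Ioo (0 : ℝ) 1) :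
    IntegrableOn (fun u : ℝ => Real.sin (u / 2) ^ 2 / u ^ 2 * u ^ α) (Set.Ioi 0) ∧
      ∫ u in Set.Ioi (0 : ℝ), Real.sin (u / 2) ^ 2 / u ^ 2 * u ^ α =
        Real.Gamma (α - 1) * Real.sin (-α * Real.pi / 2) / 2 := by
  obtain ⟨hi, he⟩ := integral_one_sub_cos_mul_rpow hα
  have h : ∀ u ∈ Set.Ioi (0 : ℝ), (1 - Real.cos u) * u ^ (α - 2) / 2 =
      Real.sin (u / 2) ^ 2 / u ^ 2 * u ^ α := by
    intro u hu
    have hu' : (0 : ℝ) < u := hu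
    rw [Real.sin_sq_eq_half_sub, mul_div_cancel₀ u two_ne_zero, Real.rpow_sub hu', Real.rpow_two]
    field_simp
  refine ⟨IntegrableOn.congr_fun (hi.div_const 2) h measurableSet_Ioi, ?_⟩
  rw [← setIntegral_congr_fun measurableSet_Ioi h, integral_div, he]

/-! ### Power bound and asymptotics of the variance function -/

section variogram

variable {α c a : ℝ}

lemma f_zero : f α c a 0 = 0 := by simp [f]

lemma f_integrand_nonneg (hc : 0 < c) {s u : ℝ} (hs : 0 ≤ s) (hu : 0 ≤ u) :
    0 ≤ Real.sin (u / 2) ^ 2 / u ^ 2 * (1 - Real.exp (-2 * c * (u / s) ^ α)) := by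
  refine mul_nonneg (by positivity) (sub_nonneg.2 (Real.exp_le_one_iff.2 ?_))
  have : 0 ≤ c * (u / s) ^ α := by positivity
  nlinarith

lemma f_integrand_le {s u : ℝ} (hs : 0 ≤ s) (hu : 0 ≤ u) :
    Real.sin (u / 2) ^ 2 / u ^ 2 * (1 - Real.exp (-2 * c * (u / s) ^ α)) ≤
      2 * c / s ^ α * (Real.sin (u / 2) ^ 2 / u ^ 2 * u ^ α) := by
  have h := Real.add_one_le_exp (-2 * c * (u / s) ^ α)
  rw [Real.div_rpow hu hs] at h ⊢
  have h2 : 1 - Real.exp (-2 * c * (u ^ α / s ^ α)) ≤ 2 * c * (u ^ α / s ^ α) := by linarith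
  refine (mul_le_mul_of_nonneg_left h2 (by positivity)).trans (le_of_eq ?_)
  ring

lemma f_le (hα : α ∈ Set.Ioo (0 : ℝ) 1) (hc : 0 < c) (ha : 0 < a) {s : ℝ} (hs : 0 ≤ s) :
    f α c a s ≤ k α c a * s ^ (1 - α) := by
  rcases hs.eq_or_lt with rfl | hs'
  · rw [f_zero, Real.zero_rpow (by linarith [hα.2]), mul_zero]
  obtain ⟨hi, he⟩ := integral_sin_sq_mul_rpow hα
  have h : ∫ u in Set.Ioi (0 : ℝ),
      Real.sin (u / 2) ^ 2 / u ^ 2 * (1 - Real.exp (-2 * c * (u / s) ^ α)) ≤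
      2 * c / s ^ α * (Real.Gamma (α - 1) * Real.sin (-α * Real.pi / 2) / 2) := by
    rw [← he, ← integral_const_mul]
    refine integral_mono_of_nonneg ?_ (hi.const_mul _) ?_
    · filter_upwards [ae_restrict_mem measurableSet_Ioi] with u hu
      exact f_integrand_nonneg hc hs (le_of_lt hu)
    · filter_upwards [ae_restrict_mem measurableSet_Ioi] with u hu
      exact f_integrand_le hs (le_of_lt hu)
  unfold f k
  refine (mul_le_mul_of_nonneg_left h (by positivity)).trans (le_of_eq ?_)
  rw [Real.rpow_sub hs', Real.rpow_one]
  have := Real.rpow_pos_of_pos hs' α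
  field_simp

/-- This is the derivative of z ↦ -e^(-xz) at 0, read along z = 1/y. -/
lemma tendsto_one_sub_exp_mul (x : ℝ) :
    Tendsto (fun y : ℝ => y * (1 - Real.exp (-x / y))) atTop (𝓝 x) := by
  have h : HasDerivAt (fun z : ℝ => -Real.exp (-x * z)) x 0 := by
    refine (((hasDerivAt_id (0 : ℝ)).const_mul (-x)).exp).neg.congr_deriv ?_
    simp
  have h2 := (hasDerivAt_iff_tendsto_slope_zero.1 h).comp
    ((tendsto_nhdsWithin_iff.2 ⟨tendsto_inv_atTop_zero, (eventually_ne_atTop 0).mono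
      fun y hy => by simpa using hy⟩ : Tendsto (fun y : ℝ => y⁻¹) atTop (𝓝[≠] 0)))
  refine h2.congr fun y => ?_
  simp only [Function.comp_apply, zero_add, mul_zero, Real.exp_zero, smul_eq_mul, inv_inv,
    div_eq_mul_inv]
  ring

lemma tendsto_f_div_rpow (hα : α ∈ Set.Ioo (0 : ℝ) 1) (hc : 0 < c) :
    Tendsto (fun s => f α c a s / s ^ (1 - α)) atTop (𝓝 (k α c a)) := by
  obtain ⟨hi, he⟩ := integral_sin_sq_mul_rpow hα
  have key : Tendsto (fun s : ℝ => ∫ u in Set.Ioi (0 : ℝ),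
      Real.sin (u / 2) ^ 2 / u ^ 2 * (s ^ α * (1 - Real.exp (-2 * c * (u / s) ^ α)))) atTop
      (𝓝 (∫ u in Set.Ioi (0 : ℝ), Real.sin (u / 2) ^ 2 / u ^ 2 * (2 * c * u ^ α))) := by
    refine tendsto_integral_filter_of_dominated_convergence
      (fun u => 2 * c * (Real.sin (u / 2) ^ 2 / u ^ 2 * u ^ α)) ?_ ?_ (hi.const_mul _) ?_
    · exact Eventually.of_forall fun s => by
        refine Measurable.aestronglyMeasurable ?_
        fun_prop
    · filter_upwards [eventually_gt_atTop 0] with s hs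
      filter_upwards [ae_restrict_mem measurableSet_Ioi] with u hu
      have hs' := Real.rpow_pos_of_pos hs α
      have h1 := f_integrand_nonneg (α := α) hc hs.le (le_of_lt hu)
      have h2 := f_integrand_le (α := α) (c := c) hs.le (le_of_lt hu)
      rw [mul_left_comm, Real.norm_eq_abs, abs_of_nonneg (mul_nonneg hs'.le h1)]
      refine (mul_le_mul_of_nonneg_left h2 hs'.le).trans (le_of_eq ?_)
      field_simp
    · filter_upwards [ae_restrict_mem measurableSet_Ioi] with u hu
      refine Tendsto.const_mul _ ?_
      refine ((tendsto_one_sub_exp_mul (2 * c * u ^ α)).comp (tendsto_rpow_atTop hα.1)).congr' ?_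
      filter_upwards [eventually_gt_atTop 0] with s hs
      simp only [Function.comp_apply]
      rw [Real.div_rpow (le_of_lt hu) hs.le]
      ring_nf
  have hk : 4 / (a * Real.pi) *
      ∫ u in Set.Ioi (0 : ℝ), Real.sin (u / 2) ^ 2 / u ^ 2 * (2 * c * u ^ α) = k α c a := by
    simp_rw [mul_left_comm _ (2 * c)]
    rw [integral_const_mul, he, k]
    ring
  rw [← hk]
  refine (key.const_mul _).congr' ?_
  filter_upwards [eventually_gt_atTop 0] with s hs
  simp_rw [mul_left_comm _ (s ^ α)]
  rw [integral_const_mul, f, Real.rpow_sub hs, Real.rpow_one]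
  have hs' := Real.rpow_pos_of_pos hs α
  field_simp

end variogram

/-! ### Compact sets of paths -/

/-- The paths starting at `0` whose oscillation over distances at most `2⁻ⁿ` in `[0, N]` is at
most `L N * θ ^ n`. -/
def modulusSet (θ : ℝ) (L : ℕ → ℝ) : Set C(ℝ≥0, ℝ) :=
  {x | x 0 = 0 ∧ ∀ N n : ℕ, ∀ s t : ℝ≥0, s ≤ N → t ≤ N → dist s t ≤ (1 / 2) ^ n →
    |x s - x t| ≤ L N * θ ^ n}

lemma equicontinuous_of_modulus {θ : ℝ} (h0 : 0 ≤ θ) (h1 : θ < 1) {L : ℕ → ℝ} {ι : Type*}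
    {x : ι → ℝ≥0 → ℝ}
    (hx : ∀ i, ∀ N n : ℕ, ∀ s t : ℝ≥0, s ≤ N → t ≤ N → dist s t ≤ (1 / 2) ^ n →
      |x i s - x i t| ≤ L N * θ ^ n) : Equicontinuous x := by
  intro t
  rw [Metric.equicontinuousAt_iff_right]
  intro ε hε
  -- The margin 1 keeps every `s` within 2⁻ⁿ of `t` inside `[0, N]`.
  obtain ⟨N, hN⟩ := exists_nat_ge (t + 1)
  have hlim : Tendsto (fun n : ℕ => L N * θ ^ n) atTop (𝓝 0) := by
    simpa using (tendsto_pow_atTop_nhds_zero_of_lt_one h0 h1).const_mul (L N)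
  obtain ⟨n, hn⟩ := (hlim.eventually_lt_const hε).exists
  have hpos : (0 : ℝ) < (1 / 2) ^ n := by positivity
  filter_upwards [Metric.closedBall_mem_nhds t hpos] with s hs i
  rw [Real.dist_eq]
  rw [Metric.mem_closedBall, dist_comm] at hs
  refine (hx i N n t s (le_trans (by simp) hN) ?_ hs).trans_lt hn
  refine le_trans ?_ hN
  rw [NNReal.dist_eq] at hs
  have h2 : ((1 : ℝ) / 2) ^ n ≤ 1 := pow_le_one₀ (by norm_num) (by norm_num)
  have h3 := (abs_le.1 hs).1
  rw [← NNReal.coe_le_coe]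
  push_cast
  linarith

lemma abs_le_of_modulus {θ : ℝ} {L : ℕ → ℝ} {x : ℝ≥0 → ℝ} (hx0 : x 0 = 0)
    (hx : ∀ N n : ℕ, ∀ s t : ℝ≥0, s ≤ N → t ≤ N → dist s t ≤ (1 / 2) ^ n →
      |x s - x t| ≤ L N * θ ^ n) (N : ℕ) :
    ∀ j : ℕ, j ≤ N → ∀ t : ℝ≥0, t ≤ j → |x t| ≤ j * L N := by
  intro j
  induction j with
  | zero =>
    intro _ t ht
    have : t = 0 := by simpa using ht
    simp [this, hx0]
  | succ j ih =>
    intro hj t ht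
    have htN : t ≤ N := ht.trans (by exact_mod_cast hj)
    -- Walk back to 0 in steps of length at most 1, each costing `L N` (the case n = 0); truncated
    -- subtraction stops at 0.
    have h1 := hx N 0 t (t - 1) htN (tsub_le_self.trans htN) (by
      rw [pow_zero, NNReal.dist_eq]
      rcases le_total t 1 with h | h
      · rw [tsub_eq_zero_of_le h]
        simpa using h
      · rw [NNReal.coe_sub h]; simp)
    have h2 := ih (by omega) (t - 1) (by
      rw [tsub_le_iff_right]; exact_mod_cast ht)
    have h3 : |x t| ≤ |x t - x (t - 1)| + |x (t - 1)| := by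
      simpa using abs_add_le (x t - x (t - 1)) (x (t - 1))
    push_cast
    linarith

/-- Arzelà–Ascoli. The modulus condition already forces continuity, so the set is closed even among
all functions with the product topology, where it lies in a product of compact intervals. -/
lemma isCompact_modulusSet {θ : ℝ} (h0 : 0 ≤ θ) (h1 : θ < 1) (L : ℕ → ℝ) :
    IsCompact (modulusSet θ L) := by
  refine ArzelaAscoli.isCompact_of_equicontinuous _ ?_ ?_
  · have himg : ContinuousMap.toFun '' modulusSet θ L =
        {x : ℝ≥0 → ℝ | x 0 = 0 ∧ ∀ N n : ℕ, ∀ s t : ℝ≥0, s ≤ N → t ≤ N →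
          dist s t ≤ (1 / 2) ^ n → |x s - x t| ≤ L N * θ ^ n} := by
      ext x
      constructor
      · rintro ⟨y, hy, rfl⟩
        exact hy
      · intro hx
        have hc : Equicontinuous fun _ : Unit => x :=
          equicontinuous_of_modulus h0 h1 fun _ => hx.2
        exact ⟨⟨x, hc.continuous ()⟩, hx, rfl⟩
    rw [himg]
    refine (isCompact_univ_pi fun t : ℝ≥0 =>
      isCompact_Icc (a := -(⌈t⌉₊ * L ⌈t⌉₊)) (b := ⌈t⌉₊ * L ⌈t⌉₊)).of_isClosed_subset ?_ ?_
    · rw [show {x : ℝ≥0 → ℝ | x 0 = 0 ∧ ∀ N n : ℕ, ∀ s t : ℝ≥0, s ≤ N → t ≤ N →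
          dist s t ≤ (1 / 2) ^ n → |x s - x t| ≤ L N * θ ^ n} = {x | x 0 = 0} ∩
          ⋂ (N : ℕ) (n : ℕ) (s : ℝ≥0) (t : ℝ≥0) (_ : s ≤ N) (_ : t ≤ N)
          (_ : dist s t ≤ (1 / 2) ^ n), {x | |x s - x t| ≤ L N * θ ^ n} by ext; simp]
      refine IsClosed.inter (isClosed_eq (continuous_apply _) continuous_const) ?_
      refine isClosed_iInter fun N => isClosed_iInter fun n => isClosed_iInter fun s =>
        isClosed_iInter fun t => isClosed_iInter fun _ => isClosed_iInter fun _ =>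
        isClosed_iInter fun _ => isClosed_le (by fun_prop) continuous_const
    · intro x hx t _
      exact abs_le.1 (abs_le_of_modulus hx.1 hx.2 _ _ le_rfl t (Nat.le_ceil t))
  · exact equicontinuous_of_modulus h0 h1 fun x : modulusSet θ L => x.2.2

/-! ### Dyadic chaining -/

/-- The largest dyadic number of level `m` below `s`. -/
noncomputable def dyadicFloor (m : ℕ) (s : ℝ≥0) : ℝ≥0 := (⌊s * 2 ^ m⌋₊ : ℝ≥0) / 2 ^ m

lemma tendsto_dyadicFloor (s : ℝ≥0) : Tendsto (fun m => dyadicFloor m s) atTop (𝓝 s) := by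
  rw [tendsto_iff_dist_tendsto_zero]
  refine squeeze_zero (fun _ => dist_nonneg) (g := fun m : ℕ => ((1 : ℝ) / 2) ^ m) (fun m => ?_)
    (tendsto_pow_atTop_nhds_zero_of_lt_one (by norm_num) (by norm_num))
  have h1 : ((⌊s * 2 ^ m⌋₊ : ℕ) : ℝ) ≤ s * 2 ^ m := by
    exact_mod_cast Nat.floor_le (zero_le (a := s * 2 ^ m))
  have h2 : (s : ℝ) * 2 ^ m < (⌊s * 2 ^ m⌋₊ : ℕ) + 1 := by
    exact_mod_cast Nat.lt_floor_add_one (s * 2 ^ m)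
  have h3 : (0 : ℝ) < 2 ^ m := by positivity
  rw [NNReal.dist_eq, dyadicFloor, abs_sub_comm]
  push_cast
  rw [show (s : ℝ) - (⌊s * 2 ^ m⌋₊ : ℕ) / 2 ^ m = (s * 2 ^ m - (⌊s * 2 ^ m⌋₊ : ℕ)) / 2 ^ m by
    field_simp, one_div, inv_pow, abs_of_nonneg (by apply div_nonneg <;> linarith),
    ← one_div]
  gcongr
  linarith

section chaining

variable {θ M : ℝ} {N : ℕ} {x : ℝ≥0 → ℝ}

/-- Refining the grid by one level either keeps the dyadic floor or moves it to the next grid point.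
-/
lemma dyadicFloor_step (h0 : 0 ≤ θ) (hM : 0 ≤ M)
    (hx : ∀ n j : ℕ, j + 1 ≤ N * 2 ^ n →
      |x (((j + 1 : ℕ) : ℝ≥0) / 2 ^ n) - x ((j : ℝ≥0) / 2 ^ n)| ≤ M * θ ^ n)
    {s : ℝ≥0} (hs : s ≤ N) (m : ℕ) :
    |x (dyadicFloor (m + 1) s) - x (dyadicFloor m s)| ≤ M * θ ^ (m + 1) := by
  have e : dyadicFloor m s = ((2 * ⌊s * 2 ^ m⌋₊ : ℕ) : ℝ≥0) / 2 ^ (m + 1) := by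
    rw [dyadicFloor, pow_succ]
    push_cast
    field_simp
  have hle : s * 2 ^ (m + 1) ≤ (N * 2 ^ (m + 1) : ℕ) := by
    push_cast
    gcongr
  have hfl : ⌊s * 2 ^ (m + 1)⌋₊ ≤ N * 2 ^ (m + 1) := by
    have := (Nat.floor_le (zero_le (a := s * 2 ^ (m + 1)))).trans hle
    exact_mod_cast this
  have hlo : 2 * ⌊s * 2 ^ m⌋₊ ≤ ⌊s * 2 ^ (m + 1)⌋₊ := by
    refine Nat.le_floor ?_
    have := Nat.floor_le (zero_le (a := s * 2 ^ m))
    push_cast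
    calc (2 : ℝ≥0) * ⌊s * 2 ^ m⌋₊ ≤ 2 * (s * 2 ^ m) := by gcongr
      _ = s * 2 ^ (m + 1) := by ring
  have hhi : ⌊s * 2 ^ (m + 1)⌋₊ < 2 * ⌊s * 2 ^ m⌋₊ + 2 := by
    rw [Nat.floor_lt zero_le]
    have := Nat.lt_floor_add_one (s * 2 ^ m)
    push_cast
    calc s * 2 ^ (m + 1) = 2 * (s * 2 ^ m) := by ring
      _ < 2 * (⌊s * 2 ^ m⌋₊ + 1) := by gcongr
      _ = _ := by ring
  rw [e, dyadicFloor]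
  obtain h | h : ⌊s * 2 ^ (m + 1)⌋₊ = 2 * ⌊s * 2 ^ m⌋₊ ∨
      ⌊s * 2 ^ (m + 1)⌋₊ = 2 * ⌊s * 2 ^ m⌋₊ + 1 := by omega
  · rw [h, sub_self, abs_zero]
    positivity
  · rw [h]
    exact hx _ _ (h ▸ hfl)

/-- Telescope along finer dyadic floors: the steps sum geometrically, and continuity identifies the
limit. -/
lemma abs_sub_dyadicFloor_le (h0 : 0 ≤ θ) (h1 : θ < 1) (hM : 0 ≤ M) (hc : Continuous x)
    (hx : ∀ n j : ℕ, j + 1 ≤ N * 2 ^ n →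
      |x (((j + 1 : ℕ) : ℝ≥0) / 2 ^ n) - x ((j : ℝ≥0) / 2 ^ n)| ≤ M * θ ^ n)
    {s : ℝ≥0} (hs : s ≤ N) (n : ℕ) :
    |x (dyadicFloor n s) - x s| ≤ M * θ ^ n / (1 - θ) := by
  have ht : Tendsto (fun m => x (dyadicFloor (m + n) s)) atTop (𝓝 (x s)) :=
    (hc.tendsto s).comp ((tendsto_dyadicFloor s).comp (tendsto_add_atTop_nat n))
  have := dist_le_of_le_geometric_of_tendsto₀ θ (M * θ ^ n) h1 (fun m => ?_) ht
  · simpa [Real.dist_eq] using this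
  · rw [dist_comm, Real.dist_eq, show m + 1 + n = m + n + 1 by ring]
    refine (dyadicFloor_step h0 hM hx hs (m + n)).trans ?_
    rw [mul_assoc, ← pow_add]
    exact mul_le_mul_of_nonneg_left (pow_le_pow_of_le_one h0 h1.le (by omega)) hM

/-- Control of the increments between dyadic neighbours bounds the modulus of continuity. -/
lemma modulus_of_dyadic (h0 : 0 ≤ θ) (h1 : θ < 1) (hM : 0 ≤ M) (hc : Continuous x)
    (hx : ∀ n j : ℕ, j + 1 ≤ N * 2 ^ n →
      |x (((j + 1 : ℕ) : ℝ≥0) / 2 ^ n) - x ((j : ℝ≥0) / 2 ^ n)| ≤ M * θ ^ n)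
    (n : ℕ) {s t : ℝ≥0} (hs : s ≤ N) (ht : t ≤ N) (hst : dist s t ≤ (1 / 2) ^ n) :
    |x s - x t| ≤ M * (1 + 2 / (1 - θ)) * θ ^ n := by
  wlog hle : s ≤ t generalizing s t
  · rw [abs_sub_comm]
    exact this ht hs (by rwa [dist_comm]) (le_of_not_ge hle)
  have hs' := abs_sub_dyadicFloor_le h0 h1 hM hc hx hs n
  have ht' := abs_sub_dyadicFloor_le h0 h1 hM hc hx ht n
  have hmid : |x (dyadicFloor n t) - x (dyadicFloor n s)| ≤ M * θ ^ n := by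
    have hle' : t * 2 ^ n ≤ (N * 2 ^ n : ℕ) := by
      push_cast
      gcongr
    have hfl : ⌊t * 2 ^ n⌋₊ ≤ N * 2 ^ n := by
      have := (Nat.floor_le (zero_le (a := t * 2 ^ n))).trans hle'
      exact_mod_cast this
    have hlo : ⌊s * 2 ^ n⌋₊ ≤ ⌊t * 2 ^ n⌋₊ := Nat.floor_mono (by gcongr)
    have hhi : ⌊t * 2 ^ n⌋₊ ≤ ⌊s * 2 ^ n⌋₊ + 1 := by
      rw [← Nat.floor_add_one zero_le]
      refine Nat.floor_mono ?_
      rw [NNReal.dist_eq] at hst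
      have h2 := (abs_le.1 hst).1
      have h3 : (0 : ℝ) < 2 ^ n := by positivity
      rw [one_div, inv_pow] at h2
      rw [← NNReal.coe_le_coe]
      push_cast
      have h4 : (t : ℝ) * 2 ^ n ≤ (s + (2 ^ n)⁻¹) * 2 ^ n := by gcongr; linarith
      rwa [add_mul, inv_mul_cancel₀ h3.ne'] at h4
    rw [dyadicFloor, dyadicFloor]
    obtain h | h : ⌊t * 2 ^ n⌋₊ = ⌊s * 2 ^ n⌋₊ ∨ ⌊t * 2 ^ n⌋₊ = ⌊s * 2 ^ n⌋₊ + 1 := by omega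
    · rw [h, sub_self, abs_zero]
      positivity
    · rw [h]
      exact hx _ _ (h ▸ hfl)
  -- One step between floors that are equal or adjacent, plus one chaining tail at each endpoint.
  have e : M * (1 + 2 / (1 - θ)) * θ ^ n =
      M * θ ^ n + M * θ ^ n / (1 - θ) + M * θ ^ n / (1 - θ) := by ring
  rw [e]
  rw [abs_le] at *
  constructor <;> linarith

end chaining

/-! ### Laws on path space and their characteristic functions -/

lemma path_apply {Ω : Type*} {X : ℝ≥0 → Ω → ℝ} {ω : Ω} (h : Continuous fun s => X s ω)
    (s : ℝ≥0) : path X ω s = X s ω := by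
  simp [path, h]

/-- Evaluation along a dense sequence is a continuous injection of path space, hence a measurable
embedding, so measurability can be checked coordinatewise. -/
lemma aemeasurable_path {Ω : Type*} [MeasurableSpace Ω] {P : Measure Ω} {X : ℝ≥0 → Ω → ℝ}
    (hm : ∀ s, AEMeasurable (X s) P)
    (hc : ∀ᵐ ω ∂P, Continuous fun s => X s ω) : AEMeasurable (path X) P := by
  let ev : C(ℝ≥0, ℝ) → ℕ → ℝ := fun x n => x (TopologicalSpace.denseSeq ℝ≥0 n)
  have hev : Continuous ev := by fun_prop
  have hinj : Function.Injective ev := fun x y hxy => DFunLike.coe_injective <|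
    (TopologicalSpace.denseRange_denseSeq ℝ≥0).equalizer x.continuous y.continuous hxy
  rw [← (hev.measurableEmbedding hinj).aemeasurable_comp_iff, aemeasurable_pi_iff]
  intro n
  refine (hm (TopologicalSpace.denseSeq ℝ≥0 n)).congr ?_
  filter_upwards [hc] with ω hω using (path_apply hω _).symm

/-- A tight family of laws on path space converges as soon as the characteristic functions of its
finite dimensional distributions do. -/
lemma tendsto_of_isTight_of_tendsto_charFun {ι : Type*} {l : Filter ι}
    {μ : ι → ProbabilityMeasure C(ℝ≥0, ℝ)} {μ₀ : ProbabilityMeasure C(ℝ≥0, ℝ)}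
    (ht : IsTightMeasureSet {(μ i : Measure C(ℝ≥0, ℝ)) | i})
    (h : ∀ w : ℝ≥0 →₀ ℝ, Tendsto
      (fun i => ∫ x : C(ℝ≥0, ℝ),
        Complex.exp ((∑ s ∈ w.support, w s * x s : ℝ) * Complex.I) ∂(μ i : Measure C(ℝ≥0, ℝ))) l
      (𝓝 (∫ x : C(ℝ≥0, ℝ),
        Complex.exp ((∑ s ∈ w.support, w s * x s : ℝ) * Complex.I) ∂(μ₀ : Measure C(ℝ≥0, ℝ))))) :
    Tendsto μ l (𝓝 μ₀) := by
  -- With the discrete topology on weights, joint continuity of the pairing reduces to continuity in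
  -- the path for each fixed weight.
  let _ : TopologicalSpace (ℝ≥0 →₀ ℝ) := ⊥
  have : DiscreteTopology (ℝ≥0 →₀ ℝ) := ⟨rfl⟩
  let L : C(ℝ≥0, ℝ) →ₗ[ℝ] (ℝ≥0 →₀ ℝ) →ₗ[ℝ] ℝ :=
    LinearMap.mk₂ ℝ (fun x w => Finsupp.linearCombination ℝ (fun s => x s) w)
      (fun x y w => by simp [Finsupp.linearCombination_apply, Finsupp.sum, mul_add,
        Finset.sum_add_distrib])
      (fun c x w => by simp [Finsupp.linearCombination_apply, Finsupp.sum, Finset.mul_sum,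
        mul_left_comm])
      (fun x w w' => by simp) (fun c x w => by simp)
  have hLapp : ∀ x w, L x w = ∑ s ∈ w.support, w s * x s := fun x w => by
    simp [L, Finsupp.linearCombination_apply, Finsupp.sum]
  have hL : Continuous fun p : C(ℝ≥0, ℝ) × (ℝ≥0 →₀ ℝ) => L p.1 p.2 := by
    rw [continuous_prod_of_discrete_right]
    intro w
    simp only [hLapp]
    fun_prop
  have hint : ∀ (ν : ProbabilityMeasure C(ℝ≥0, ℝ)) (w : ℝ≥0 →₀ ℝ),
      Integrable (fun x => (Real.probChar (L x w) : ℂ)) (ν : Measure C(ℝ≥0, ℝ)) := fun ν w =>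
    BoundedContinuousFunction.integrable _
      (BoundedContinuousFunction.char Real.continuous_probChar hL w)
  -- For a tight family it suffices to test on a point-separating algebra, here the polynomials in
  -- the characters x ↦ exp(i⟨x, w⟩).
  refine ProbabilityMeasure.tendsto_of_tight_of_separatesPoints ℂ ht
    (A := BoundedContinuousFunction.charPoly Real.continuous_probChar hL)
    (BoundedContinuousFunction.separatesPoints_charPoly _ Real.probChar_ne_one _ ?_) ?_
  · intro x hx hLx
    refine hx (ContinuousMap.ext fun s => ?_)
    have := LinearMap.congr_fun hLx (Finsupp.single s 1)
    simpa [L] using this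
  · intro g hg
    obtain ⟨w, hw⟩ := (BoundedContinuousFunction.mem_charPoly g).1 hg
    have h_eq (ν : ProbabilityMeasure C(ℝ≥0, ℝ)) : ∫ x, g x ∂ν =
        w.coeff.sum fun a z => z * ∫ x, (Real.probChar (L x a) : ℂ) ∂ν := by
      simp_rw [hw, Finsupp.sum]
      rw [integral_finsetSum _ fun a _ => (hint ν a).const_mul _]
      simp_rw [integral_const_mul]
    simp_rw [h_eq]
    refine tendsto_finsetSum _ fun a _ => Tendsto.const_mul _ ?_
    simpa only [Real.probChar_apply, hLapp] using h a

/-! ### Moments and tails of centered Gaussian variables -/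

section gaussian

variable {Ω : Type*} [MeasurableSpace Ω] {P : Measure Ω}

lemma map_eq_gaussianReal_of_mean_zero {Y : Ω → ℝ} (hY : HasGaussianLaw Y P)
    (h0 : ∫ ω, Y ω ∂P = 0) : P.map Y = gaussianReal 0 Var[Y; P].toNNReal := by
  rw [hY.map_eq_gaussianReal, h0]

/-- The even moments of the standard Gaussian law. -/
noncomputable def gaussMoment (m : ℕ) : ℝ := ∫ x, x ^ (2 * m) ∂gaussianReal 0 1

/-- The law of `Y` is the standard Gaussian law scaled by the standard deviation, also when the
variance vanishes. -/
lemma integral_even_pow_gaussian {Y : Ω → ℝ} (hY : HasGaussianLaw Y P)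
    (h0 : ∫ ω, Y ω ∂P = 0) (m : ℕ) :
    Integrable (fun ω => Y ω ^ (2 * m)) P ∧
      ∫ ω, Y ω ^ (2 * m) ∂P = Var[Y; P] ^ m * gaussMoment m := by
  have hmap := map_eq_gaussianReal_of_mean_zero hY h0
  have hv : 0 ≤ Var[Y; P] := variance_nonneg _ _
  have hsc : gaussianReal 0 Var[Y; P].toNNReal =
      (gaussianReal 0 1).map fun x => √Var[Y; P] * x := by
    rw [gaussianReal_map_const_mul, mul_zero, mul_one]
    congr 1
    ext
    simp [Real.sq_sqrt hv, hv]
  have hint : Integrable (fun x : ℝ => x ^ (2 * m)) (P.map Y) := by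
    rw [hmap]
    have := (memLp_id_gaussianReal (μ := 0) (v := Var[Y; P].toNNReal)
      ((2 * m : ℕ) : ℝ≥0)).integrable_norm_pow'
    simpa [pow_mul] using this
  refine ⟨hint.comp_aemeasurable hY.aemeasurable, ?_⟩
  rw [← integral_map hY.aemeasurable (f := fun x : ℝ => x ^ (2 * m)) (by fun_prop), hmap, hsc,
    integral_map (by fun_prop) (by fun_prop)]
  simp_rw [mul_pow]
  rw [integral_const_mul, pow_mul, Real.sq_sqrt hv, gaussMoment]

lemma gaussMoment_nonneg (m : ℕ) : 0 ≤ gaussMoment m :=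
  integral_nonneg fun x => by rw [pow_mul]; positivity

/-- Markov's inequality for the 2m-th power. -/
lemma measure_lt_abs_gaussian_le [IsProbabilityMeasure P] {Y : Ω → ℝ} (hY : HasGaussianLaw Y P)
    (h0 : ∫ ω, Y ω ∂P = 0) (m : ℕ) {v r : ℝ} (hv : Var[Y; P] ≤ v) (hr : 0 < r) :
    P {ω | r < |Y ω|} ≤ ENNReal.ofReal (v ^ m * gaussMoment m / r ^ (2 * m)) := by
  obtain ⟨hi, he⟩ := integral_even_pow_gaussian hY h0 m
  have h1 := mul_meas_ge_le_integral_of_nonneg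
    (Eventually.of_forall fun ω => by simp only [Pi.zero_apply, pow_mul]; positivity)
    hi (r ^ (2 * m))
  rw [he] at h1
  have h2 : P {ω | r < |Y ω|} ≤ P {ω | r ^ (2 * m) ≤ Y ω ^ (2 * m)} := by
    refine measure_mono fun ω hω => ?_
    have : r ^ (2 * m) ≤ |Y ω| ^ (2 * m) := pow_le_pow_left₀ hr.le (le_of_lt hω) _
    simpa [pow_mul] using this
  refine h2.trans ?_
  rw [← ofReal_measureReal]
  refine ENNReal.ofReal_le_ofReal ?_
  rw [le_div_iff₀ (by positivity), mul_comm]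
  refine h1.trans ?_
  exact mul_le_mul_of_nonneg_right (pow_le_pow_left₀ (variance_nonneg _ _) hv m)
    (gaussMoment_nonneg m)

lemma ae_eq_zero_of_variance_eq_zero {Y : Ω → ℝ} (hY : HasGaussianLaw Y P)
    (h0 : ∫ ω, Y ω ∂P = 0) (hv : Var[Y; P] = 0) : ∀ᵐ ω ∂P, Y ω = 0 := by
  have hmap := map_eq_gaussianReal_of_mean_zero hY h0
  rw [hv, Real.toNNReal_zero, gaussianReal_zero_var] at hmap
  refine ae_of_ae_map hY.aemeasurable (p := fun y => y = 0) ?_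
  rw [hmap]
  simp

lemma integral_exp_gaussian {Y : Ω → ℝ} (hY : HasGaussianLaw Y P) (h0 : ∫ ω, Y ω ∂P = 0) :
    ∫ ω, Complex.exp ((Y ω : ℝ) * Complex.I) ∂P = Complex.exp (-(Var[Y; P] : ℝ) / 2) := by
  have h := charFun_gaussianReal (μ := 0) (v := Var[Y; P].toNNReal) 1
  rw [← map_eq_gaussianReal_of_mean_zero hY h0, charFun_apply_real,
    integral_map hY.aemeasurable (by fun_prop)] at h
  simp only [Complex.ofReal_one, one_mul] at h
  rw [h]
  congr 1
  rw [Real.coe_toNNReal _ (variance_nonneg _ _)]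
  push_cast
  ring

end gaussian

/-! ### Union bound over dyadic increments -/

/-- Exponents for Kolmogorov's criterion. -/
lemma exists_chaining_exponents {η : ℝ} (hη : 0 < η) :
    ∃ m : ℕ, m ≠ 0 ∧ ∃ θ ρ : ℝ, 0 < θ ∧ θ < 1 ∧ 0 < ρ ∧ ρ < 1 ∧
      ∀ n : ℕ, 2 ^ n * ((((1 : ℝ) / 2) ^ n) ^ η) ^ m = ρ ^ n * (θ ^ n) ^ (2 * m) := by
  set q : ℝ := (1 / 2 : ℝ) ^ η with hq
  have hq0 : 0 < q := by positivity
  have hq1 : q < 1 := Real.rpow_lt_one (by norm_num) (by norm_num) hη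
  -- Choose `m` with 2 q^m < 1 and split this ratio into two factors √(2 q^m): one is `ρ`, which
  -- makes the union bound summable over levels; the other is θ^(2m), which pays for the shrinking
  -- threshold.
  obtain ⟨m, hm⟩ := exists_pow_lt_of_lt_one (show (0 : ℝ) < 1 / 2 by norm_num) hq1
  have hm0 : m ≠ 0 := by
    rintro rfl
    norm_num at hm
  have hβ0 : 0 < 2 * q ^ m := by positivity
  have hρ0 : 0 < √(2 * q ^ m) := Real.sqrt_pos.2 hβ0
  have hρ1 : √(2 * q ^ m) < 1 := by
    rw [Real.sqrt_lt' one_pos]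
    linarith
  have hθ : (√(2 * q ^ m) ^ (((2 * m : ℕ) : ℝ)⁻¹)) ^ (2 * m) = √(2 * q ^ m) :=
    Real.rpow_inv_natCast_pow hρ0.le (by omega)
  refine ⟨m, hm0, √(2 * q ^ m) ^ (((2 * m : ℕ) : ℝ)⁻¹), √(2 * q ^ m), by positivity,
    Real.rpow_lt_one hρ0.le hρ1 (by positivity), hρ0, hρ1, fun n => ?_⟩
  have hqn : (((1 : ℝ) / 2) ^ n) ^ η = q ^ n := by
    rw [hq, ← Real.rpow_natCast, ← Real.rpow_mul (by norm_num), mul_comm,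
      Real.rpow_mul (by norm_num), Real.rpow_natCast]
  rw [pow_right_comm _ n, hθ, ← mul_pow, Real.mul_self_sqrt hβ0.le, mul_pow, hqn,
    pow_right_comm q]

namespace IsContinuousCenteredGaussian

variable {Ω : Type*} [MeasurableSpace Ω] {P : Measure Ω}
  {X : ℝ≥0 → Ω → ℝ} {ρ : ℝ≥0 → ℝ≥0 → ℝ}

lemma memLp_two (hX : IsContinuousCenteredGaussian X ρ P) (s : ℝ≥0) : MemLp (X s) 2 P :=
  (hX.gaussian.hasGaussianLaw_eval s).memLp_two

lemma variance_eq (hX : IsContinuousCenteredGaussian X ρ P) (s : ℝ≥0) : Var[X s; P] = ρ s s := by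
  rw [← covariance_self (hX.gaussian.aemeasurable s), hX.covariance_eq]

lemma variance_sub_eq [IsProbabilityMeasure P]
    (hX : IsContinuousCenteredGaussian X ρ P) (s t : ℝ≥0) :
    Var[fun ω => X s ω - X t ω; P] = ρ s s + ρ t t - 2 * ρ s t := by
  rw [variance_fun_sub (hX.memLp_two s) (hX.memLp_two t), hX.variance_eq, hX.variance_eq,
    hX.covariance_eq]
  ring

lemma mean_sub [IsProbabilityMeasure P] (hX : IsContinuousCenteredGaussian X ρ P) (s t : ℝ≥0) :
    ∫ ω, X s ω - X t ω ∂P = 0 := by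
  rw [integral_sub ((hX.memLp_two s).integrable one_le_two)
    ((hX.memLp_two t).integrable one_le_two), hX.mean_zero, hX.mean_zero, sub_zero]

lemma aemeasurable_path (hX : IsContinuousCenteredGaussian X ρ P) : AEMeasurable (path X) P :=
  NumVar.aemeasurable_path hX.gaussian.aemeasurable hX.continuous_paths

/-- Scaling of time and space. -/
lemma scale (hX : IsContinuousCenteredGaussian X ρ P) (b : ℝ≥0) (d : ℝ) :
    IsContinuousCenteredGaussian (fun s ω => d * X (b * s) ω)
      (fun s r => d ^ 2 * ρ (b * s) (b * r)) P where
  gaussian := (hX.gaussian.comp_right fun s => b * s).smul fun _ => d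
  mean_zero s := by rw [integral_const_mul, hX.mean_zero, mul_zero]
  covariance_eq s r := by
    rw [covariance_const_mul_left, covariance_const_mul_right, hX.covariance_eq]
    ring
  continuous_paths := by
    filter_upwards [hX.continuous_paths] with ω hω
    have : Continuous fun s : ℝ≥0 => b * s := by fun_prop
    exact (hω.comp this).const_mul d

/-- The characteristic functions of the finite dimensional distributions. -/
lemma integral_exp_path [IsProbabilityMeasure P]
    (hX : IsContinuousCenteredGaussian X ρ P) (w : ℝ≥0 →₀ ℝ) :
    ∫ x : C(ℝ≥0, ℝ), Complex.exp ((∑ s ∈ w.support, w s * x s : ℝ) * Complex.I) ∂P.map (path X) =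
      Complex.exp (-(∑ s ∈ w.support, ∑ r ∈ w.support, w s * w r * ρ s r : ℝ) / 2) := by
  have hZ : IsGaussianProcess (fun s ω => w s * X s ω) P := hX.gaussian.smul fun s => w s
  have hL : ∀ s, MemLp (fun ω => w s * X s ω) 2 P := fun s => (hX.memLp_two s).const_mul (w s)
  have hmean : ∫ ω, ∑ s ∈ w.support, w s * X s ω ∂P = 0 := by
    rw [integral_finsetSum _ fun s _ => (hL s).integrable one_le_two]
    simp [integral_const_mul, hX.mean_zero]
  have hvar : Var[fun ω => ∑ s ∈ w.support, w s * X s ω; P] =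
      ∑ s ∈ w.support, ∑ r ∈ w.support, w s * w r * ρ s r := by
    rw [variance_fun_sum' fun s _ => hL s]
    refine Finset.sum_congr rfl fun s _ => Finset.sum_congr rfl fun r _ => ?_
    rw [covariance_const_mul_left, covariance_const_mul_right, hX.covariance_eq]
    ring
  rw [integral_map hX.aemeasurable_path (Continuous.aestronglyMeasurable (by fun_prop)),
    ← hvar, ← integral_exp_gaussian hZ.hasGaussianLaw_fun_sum hmean]
  refine integral_congr_ae ?_
  filter_upwards [hX.continuous_paths] with ω hω
  simp [path_apply hω]

/-- Union bound for the increments between dyadic neighbours. -/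
lemma measure_dyadic_increments_le [IsProbabilityMeasure P]
    (hX : IsContinuousCenteredGaussian X ρ P) {η κ θ r : ℝ} {m : ℕ}
    (hθ : 0 < θ) (hr0 : 0 < r) (hr1 : r < 1) (hκ : 0 ≤ κ)
    (hexp : ∀ n : ℕ, 2 ^ n * ((((1 : ℝ) / 2) ^ n) ^ η) ^ m = r ^ n * (θ ^ n) ^ (2 * m))
    (hmod : ∀ s t, ρ s s + ρ t t - 2 * ρ s t ≤ κ * dist s t ^ η) (N : ℕ) {M : ℝ} (hM : 0 < M) :
    P (⋃ n : ℕ, ⋃ j ∈ Finset.range (N * 2 ^ n),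
        {ω | M * θ ^ n < |X (((j + 1 : ℕ) : ℝ≥0) / 2 ^ n) ω - X ((j : ℝ≥0) / 2 ^ n) ω|}) ≤
      ENNReal.ofReal (N * κ ^ m * gaussMoment m / (1 - r) / M ^ (2 * m)) := by
  have hC := gaussMoment_nonneg m
  set D : ℝ := N * κ ^ m * gaussMoment m / M ^ (2 * m) with hD
  have hD0 : 0 ≤ D := by positivity
  have hlevel : ∀ n : ℕ, P (⋃ j ∈ Finset.range (N * 2 ^ n),
      {ω | M * θ ^ n < |X (((j + 1 : ℕ) : ℝ≥0) / 2 ^ n) ω - X ((j : ℝ≥0) / 2 ^ n) ω|}) ≤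
      ENNReal.ofReal (D * r ^ n) := by
    intro n
    have hone : ∀ j ∈ Finset.range (N * 2 ^ n),
        P {ω | M * θ ^ n < |X (((j + 1 : ℕ) : ℝ≥0) / 2 ^ n) ω - X ((j : ℝ≥0) / 2 ^ n) ω|} ≤
        ENNReal.ofReal ((κ * ((1 / 2) ^ n) ^ η) ^ m * gaussMoment m / (M * θ ^ n) ^ (2 * m)) := by
      intro j _
      refine measure_lt_abs_gaussian_le hX.gaussian.hasGaussianLaw_fun_sub (hX.mean_sub _ _) m ?_
        (by positivity)
      rw [hX.variance_sub_eq]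
      refine (hmod _ _).trans (le_of_eq ?_)
      congr 2
      rw [NNReal.dist_eq]
      push_cast
      rw [← sub_div, add_sub_cancel_left, abs_of_pos (by positivity), one_div, one_div, inv_pow]
    refine (measure_biUnion_finset_le _ _).trans ((Finset.sum_le_sum hone).trans ?_)
    rw [Finset.sum_const, Finset.card_range, nsmul_eq_mul, ← ENNReal.ofReal_natCast,
      ← ENNReal.ofReal_mul (Nat.cast_nonneg _)]
    refine ENNReal.ofReal_le_ofReal (le_of_eq ?_)
    push_cast
    rw [mul_pow, mul_pow M, hD, show (N : ℝ) * 2 ^ n * (κ ^ m * (((1 / 2) ^ n) ^ η) ^ m *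
      gaussMoment m / (M ^ (2 * m) * (θ ^ n) ^ (2 * m))) = N * κ ^ m * gaussMoment m /
      (M ^ (2 * m) * (θ ^ n) ^ (2 * m)) * (2 ^ n * (((1 / 2) ^ n) ^ η) ^ m) by ring, hexp]
    field_simp
  refine (measure_iUnion_le _).trans ((ENNReal.tsum_le_tsum hlevel).trans ?_)
  rw [← ENNReal.ofReal_tsum_of_nonneg (fun n => by positivity)
    ((summable_geometric_of_lt_one hr0.le hr1).mul_left D), tsum_mul_left,
    tsum_geometric_of_lt_one hr0.le hr1]
  refine ENNReal.ofReal_le_ofReal (le_of_eq ?_)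
  rw [hD]
  ring

end IsContinuousCenteredGaussian

/-! ### Tightness and convergence of Gaussian processes -/

section convergence

variable {Ω : Type*} [MeasurableSpace Ω] {P : Measure Ω} [IsProbabilityMeasure P]
  {ι : Type*} {X : ι → ℝ≥0 → Ω → ℝ} {ρ : ι → ℝ≥0 → ℝ≥0 → ℝ} {η κ : ℝ}

/-- Kolmogorov's tightness criterion for continuous centered Gaussian processes. -/
lemma isTightMeasureSet_map_path (hX : ∀ i, IsContinuousCenteredGaussian (X i) (ρ i) P)
    (h0 : ∀ i, ρ i 0 0 = 0) (hη : 0 < η) (hκ : 0 ≤ κ)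
    (hmod : ∀ i s t, ρ i s s + ρ i t t - 2 * ρ i s t ≤ κ * dist s t ^ η) :
    IsTightMeasureSet {P.map (path (X i)) | i} := by
  rw [isTightMeasureSet_iff_exists_isCompact_measure_compl_le]
  intro ε hε
  obtain ⟨m, hm, θ, r, hθ0, hθ1, hr0, hr1, hexp⟩ := exists_chaining_exponents hη
  obtain ⟨δ, hδ0, hδ⟩ := ENNReal.exists_pos_sum_of_countable hε.ne' ℕ
  set D : ℕ → ℝ := fun N => N * κ ^ m * gaussMoment m / (1 - r) with hD
  have hD0 : ∀ N, 0 ≤ D N := fun N => by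
    have := gaussMoment_nonneg m
    have : 0 < 1 - r := by linarith
    positivity
  -- The summand 1 ensures M ≥ 1, hence M ≤ M^(2m), so the failure probability D / M^(2m) on `[0,
  -- N]` is at most `δ N`; the `δ N` sum to less than `ε`.
  set M : ℕ → ℝ := fun N => D N / δ N + 1 with hMdef
  have hM1 : ∀ N, 1 ≤ M N := fun N => by
    have := hD0 N
    have : 0 ≤ D N / δ N := by positivity
    simp only [hMdef]
    linarith
  have hDM : ∀ N, D N / M N ^ (2 * m) ≤ δ N := fun N => by
    have h1 := hM1 N
    have h2 : M N ≤ M N ^ (2 * m) := le_self_pow₀ h1 (by omega)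
    have hδN : (0 : ℝ) < δ N := hδ0 N
    rw [div_le_iff₀ (by positivity)]
    refine le_trans ?_ (mul_le_mul_of_nonneg_left h2 hδN.le)
    simp only [hMdef]
    rw [mul_add, mul_div_cancel₀ _ hδN.ne']
    linarith
  have hK := isCompact_modulusSet hθ0.le hθ1 fun N => M N * (1 + 2 / (1 - θ))
  refine ⟨_, hK, ?_⟩
  rintro _ ⟨i, rfl⟩
  rw [Measure.map_apply_of_aemeasurable (hX i).aemeasurable_path hK.isClosed.measurableSet.compl]
  set B : ℕ → Set Ω := fun N => ⋃ n : ℕ, ⋃ j ∈ Finset.range (N * 2 ^ n),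
    {ω | M N * θ ^ n < |X i (((j + 1 : ℕ) : ℝ≥0) / 2 ^ n) ω - X i ((j : ℝ≥0) / 2 ^ n) ω|} with hB
  have hX0 : ∀ᵐ ω ∂P, X i 0 ω = 0 :=
    ae_eq_zero_of_variance_eq_zero ((hX i).gaussian.hasGaussianLaw_eval 0) ((hX i).mean_zero 0)
      (((hX i).variance_eq 0).trans (h0 i))
  have hsub : path (X i) ⁻¹' (modulusSet θ fun N => M N * (1 + 2 / (1 - θ)))ᶜ ≤ᵐ[P]
      ⋃ N, B N := by
    filter_upwards [(hX i).continuous_paths, hX0] with ω hc hω0 hω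
    by_contra hnot
    refine hω ⟨by rw [path_apply hc, hω0], fun N n s t hs ht hst => ?_⟩
    rw [path_apply hc, path_apply hc]
    refine modulus_of_dyadic hθ0.le hθ1 (zero_le_one.trans (hM1 N)) hc (fun n j hj => ?_)
      n hs ht hst
    by_contra hlt
    exact hnot (Set.mem_iUnion.2 ⟨N, Set.mem_iUnion.2 ⟨n, Set.mem_iUnion₂.2
      ⟨j, Finset.mem_range.2 hj, not_le.1 hlt⟩⟩⟩)
  calc P (path (X i) ⁻¹' (modulusSet θ fun N => M N * (1 + 2 / (1 - θ)))ᶜ)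
      ≤ P (⋃ N, B N) := measure_mono_ae hsub
    _ ≤ ∑' N, P (B N) := measure_iUnion_le _
    _ ≤ ∑' N, (δ N : ENNReal) := ENNReal.tsum_le_tsum fun N => by
        refine ((hX i).measure_dyadic_increments_le hθ0 hr0 hr1 hκ hexp (hmod i) N
          (zero_lt_one.trans_le (hM1 N))).trans ?_
        rw [← ENNReal.ofReal_coe_nnreal]
        exact ENNReal.ofReal_le_ofReal (hDM N)
    _ ≤ ε := hδ.le

/-- Convergence in distribution on path space of continuous centered Gaussian processes, from
convergence of the covariances and a uniform Hölder bound on the variance of increments. -/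
theorem tendstoInDistribution_path {Ω' : Type*} [MeasurableSpace Ω'] {P' : Measure Ω'}
    [IsProbabilityMeasure P'] {Z : ℝ≥0 → Ω' → ℝ} {ρ' : ℝ≥0 → ℝ≥0 → ℝ} {l : Filter ι}
    (hX : ∀ i, IsContinuousCenteredGaussian (X i) (ρ i) P)
    (hZ : IsContinuousCenteredGaussian Z ρ' P')
    (hρ : ∀ s r, Tendsto (fun i => ρ i s r) l (𝓝 (ρ' s r)))
    (h0 : ∀ i, ρ i 0 0 = 0) (hη : 0 < η) (hκ : 0 ≤ κ)
    (hmod : ∀ i s t, ρ i s s + ρ i t t - 2 * ρ i s t ≤ κ * dist s t ^ η) :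
    TendstoInDistribution (fun i => path (X i)) l (path Z) (fun _ => P) P' where
  forall_aemeasurable i := (hX i).aemeasurable_path
  aemeasurable_limit := hZ.aemeasurable_path
  tendsto := by
    refine tendsto_of_isTight_of_tendsto_charFun (isTightMeasureSet_map_path hX h0 hη hκ hmod)
      fun w => ?_
    simp only [ProbabilityMeasure.coe_mk, hZ.integral_exp_path, (hX _).integral_exp_path]
    refine (Complex.continuous_exp.tendsto _).comp (Tendsto.div_const (Tendsto.neg ?_) _)
    refine (Complex.continuous_ofReal.tendsto _).comp ?_
    exact tendsto_finsetSum _ fun s _ => tendsto_finsetSum _ fun r _ => (hρ s r).const_mul _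

end convergence

/-! ### The rescaled variance function -/

section rescaling

variable {α c a : ℝ}

lemma f_rescale_le (hα : α ∈ Set.Ioo (0 : ℝ) 1) (hc : 0 < c) (ha : 0 < a) (b : ℝ≥0) {x : ℝ}
    (hx : 0 ≤ x) : f α c a (b * x) / (b : ℝ) ^ (1 - α) ≤ k α c a * x ^ (1 - α) := by
  have hk := (k_pos hα hc ha).le
  -- This form also admits `b = 0`, where the quotient is 0 by convention; the tightness bound is
  -- needed for every index `b`.
  refine div_le_of_le_mul₀ (by positivity) (by positivity) ?_
  refine (f_le hα hc ha (by positivity)).trans (le_of_eq ?_)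
  rw [Real.mul_rpow b.coe_nonneg hx]
  ring

lemma tendsto_f_rescale (hα : α ∈ Set.Ioo (0 : ℝ) 1) (hc : 0 < c) {x : ℝ} (hx : 0 ≤ x) :
    Tendsto (fun b : ℝ≥0 => f α c a (b * x) / (b : ℝ) ^ (1 - α)) atTop
      (𝓝 (k α c a * x ^ (1 - α))) := by
  rcases hx.eq_or_lt with rfl | hx'
  · simp [f_zero, Real.zero_rpow (sub_pos.2 hα.2).ne']
  have h1 : Tendsto (fun b : ℝ≥0 => (b : ℝ) * x) atTop atTop :=
    (NNReal.tendsto_coe_atTop.2 tendsto_id).atTop_mul_const hx'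
  refine (((tendsto_f_div_rpow hα hc).comp h1).mul_const (x ^ (1 - α))).congr fun b => ?_
  have := Real.rpow_pos_of_pos hx' (1 - α)
  simp only [Function.comp_apply]
  rw [Real.mul_rpow b.coe_nonneg hx, div_mul_eq_mul_div, mul_div_mul_right _ _ this.ne']

end rescaling

end NumVar

theorem mainTheorem9 {Ω : Type*} [MeasurableSpace Ω] {P : Measure Ω} [IsProbabilityMeasure P]
    {Ω' : Type*} [MeasurableSpace Ω'] {P' : Measure Ω'} [IsProbabilityMeasure P']
    (α c a : ℝ) (hα : α ∈ Set.Ioo (0 : ℝ) 1) (hc : 0 < c) (ha : 0 < a)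
    (G : ℝ≥0 → Ω → ℝ) (hG : NumVar.IsFluctuationProcess α c a G P)
    (W : ℝ≥0 → Ω' → ℝ) (hW : NumVar.IsFractionalBrownianMotion ((1 - α) / 2) W P') :
    0 < NumVar.k α c a ∧
    TendstoInDistribution (fun b : ℝ≥0 => NumVar.path (NumVar.rescale α b G)) atTop
      (NumVar.path (fun s ω => Real.sqrt (NumVar.k α c a) * W s ω)) (fun _ => P) P' := by
  have hk := NumVar.k_pos hα hc ha
  refine ⟨hk, ?_⟩
  have hη : 0 < 1 - α := sub_pos.2 hα.2
  let g : ℝ≥0 → ℝ → ℝ := fun b x => NumVar.f α c a (b * x) / (b : ℝ) ^ (1 - α)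
  have hg0 : ∀ b, g b 0 = 0 := fun b => by simp [g, NumVar.f_zero]
  have hX : ∀ b : ℝ≥0, NumVar.IsContinuousCenteredGaussian (NumVar.rescale α b G)
      (fun s r => (g b s + g b r - g b |(s : ℝ) - r|) / 2) P := by
    intro b
    have h := NumVar.IsContinuousCenteredGaussian.scale hG b (√((b : ℝ) ^ (1 - α)))⁻¹
    convert h using 1
    · ext s ω
      rw [NumVar.rescale, div_eq_inv_mul]
    · ext s r
      rw [inv_pow, Real.sq_sqrt (by positivity)]
      push_cast
      rw [← mul_sub, abs_mul, abs_of_nonneg b.coe_nonneg]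
      simp only [g]
      ring
  have hZ : NumVar.IsContinuousCenteredGaussian (fun s ω => √(NumVar.k α c a) * W s ω)
      (fun s r => (NumVar.k α c a * (s : ℝ) ^ (1 - α) + NumVar.k α c a * (r : ℝ) ^ (1 - α) -
        NumVar.k α c a * |(s : ℝ) - r| ^ (1 - α)) / 2) P' := by
    -- Only space is scaled, and 2H = 1 - α.
    have h := NumVar.IsContinuousCenteredGaussian.scale hW 1 √(NumVar.k α c a)
    convert h using 1
    · simp only [one_mul]
    · ext s r
      rw [Real.sq_sqrt hk.le, one_mul, one_mul, mul_div_cancel₀ (1 - α) two_ne_zero]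
      ring
  refine NumVar.tendstoInDistribution_path (η := 1 - α) hX hZ (fun s r => ?_) (fun b => ?_) hη
    hk.le fun b s t => ?_
  · exact (((NumVar.tendsto_f_rescale hα hc s.coe_nonneg).add
      (NumVar.tendsto_f_rescale hα hc r.coe_nonneg)).sub
      (NumVar.tendsto_f_rescale hα hc (abs_nonneg _))).div_const 2
  · simp [hg0]
  · rw [NNReal.dist_eq]
    -- Since `g b 0 = 0`, the increment variance collapses to `g b |s - t|`, giving the Hölder bound
    -- with constant `k` and exponent 1 - α.
    refine le_trans (le_of_eq ?_) (NumVar.f_rescale_le hα hc ha b (abs_nonneg _))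
    simp only [sub_self, abs_zero, hg0]
    simp only [g]
    ring
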